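/- Let $n\ge 1$ and $m\ge 0$ be integers. Write $[m]=\{1,\dots,m\}$. Let $\mathcal I_{n,m}$ be the set of all collections $I$ of $(n-1)$-element subsets of $[m]$ such that $$\Bigl|\bigcap_{A\in S}A\Bigr|\le n-|S|\qquad\text{for every nonempty } S\subseteq I$$ (equivalently, for no $t$ do $t+1$ of the sets in $I$ contain a common $(n-t)$-set). Let $\mathcal H_{n,m}$ be the matroid on the ground set $\binom{[m]}{n-1}$ whose independent sets are the members of $\mathcal I_{n,m}$. **Theorem.** If a central arrangement of hyperplanes $H_1,\dots,H_m$ in $\mathbb C^n$ is generic enough, then the matroid of the $\binom{m}{n-1}$ lines $H_A=\bigcap_{a\in A}H_a$, $|A|=n-1$, is isomorphic to $\mathcal H_{n,m}$. Precisely: there is a nonzero polynomial $P$ in $mn$ variables with complex coefficients such that, for all vectors $a_1,\dots,a_m\in\mathbb C^n$ with $P(a_1,\dots,a_m)\ne 0$, every $a_i$ is nonzero and the hyperplanes $H_i=\{x\in\mathbb C^n:\sum_j a_{ij}x_j=0\}$ have the following properties. 1. $\dim H_A=\max(n-|A|,0)$ for every $A\subseteq[m]$ (where $H_\emptyset=\mathbb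 C^n$). 2. The subspaces $H_A$ with $|A|=n-1$ are pairwise distinct lines, and there are exactly $\binom{m}{n-1}$ one-dimensional subspaces of the form $H_A$, $A\subseteq[m]$. 3. For any vectors $v_A$ spanning the lines $H_A$ ($|A|=n-1$), the linear matroid of the family $(v_A)$ on the ground set $\binom{[m]}{n-1}$ equals $\mathcal H_{n,m}$; that is, $\{v_A\}_{A\in I}$ is linearly independent if and only if $I\in\mathcal I_{n,m}$, for every $I\subseteq\binom{[m]}{n-1}$. -/

import Mathlib

namespace GenericLines

/-- The hyperplane through the origin of `ℂⁿ` with normal (co)vector `a`, that is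
`{x | a₁ x₁ + ⋯ + aₙ xₙ = 0}` (a genuine hyperplane exactly when `a ≠ 0`). -/
def hyperplane {n : ℕ} (a : Fin n → ℂ) : Submodule ℂ (Fin n → ℂ) where
  carrier := {x | ∑ j, a j * x j = 0}
  add_mem' := by
    intro x y hx hy
    simp only [Set.mem_ofPred_eq, Pi.add_apply, mul_add, Finset.sum_add_distrib] at *
    rw [hx, hy, add_zero]
  zero_mem' := by simp
  smul_mem' := by
    intro c x hx
    simp only [Set.mem_ofPred_eq, Pi.smul_apply, smul_eq_mul] at *
    simp only [mul_left_comm, ← Finset.mul_sum, hx, mul_zero]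

/-- The intersection `H_A` of the members of the arrangement indexed by `A`
(the whole space for `A = ∅`). -/
def flat {m n : ℕ} (H : Fin m → Submodule ℂ (Fin n → ℂ)) (A : Finset (Fin m)) :
    Submodule ℂ (Fin n → ℂ) :=
  ⨅ i ∈ A, H i

/-- A property of arrangements of `m` hyperplanes through the origin of `ℂⁿ` holds for every
generic enough arrangement: it holds whenever the `m` normal vectors avoid the zero set of some
nonzero polynomial in their coordinates. The normal vectors allowed are also required to be
nonzero, so that they define hyperplanes. -/
def ForGenericArrangement (m n : ℕ) (Q : (Fin m → Submodule ℂ (Fin n → ℂ)) → Prop) : Prop :=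
  ∃ P : MvPolynomial (Fin m × Fin n) ℂ, P ≠ 0 ∧
    ∀ a : Fin m → Fin n → ℂ, MvPolynomial.eval (fun p => a p.1 p.2) P ≠ 0 →
      (∀ i, a i ≠ 0) ∧ Q (fun i => hyperplane (a i))

/-- The linear matroid on the ground set `E` of a family of vectors: a subset of `E` is
independent when the corresponding vectors are linearly independent. -/
def vectorMatroid (K : Type*) {V ι : Type*} [Field K] [AddCommGroup V] [Module K V] [Finite ι]
    (E : Set ι) (v : ι → V) : Matroid ι :=
  (IndepMatroid.ofFinite (E := E) (Set.toFinite E) (fun I => I ⊆ E ∧ LinearIndepOn K v I)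
    ⟨Set.empty_subset _, linearIndepOn_empty K v⟩
    (fun _ _ hJ hIJ => ⟨hIJ.trans hJ.1, hJ.2.mono hIJ⟩)
    (by
      rintro I J ⟨hIE, hI⟩ ⟨hJE, hJ⟩ hlt
      by_contra! hcon
      have hsub : v '' J ⊆ Submodule.span K (v '' I) := by
        rintro _ ⟨e, he, rfl⟩
        by_contra hne
        have heI : e ∉ I := fun h => hne (Submodule.subset_span ⟨e, h, rfl⟩)
        exact hcon e he heI (Set.insert_subset (hJE he) hIE) (hI.insert hne)
      have hle := Submodule.span_le.2 hsub
      have : Fintype ι := Fintype.ofFinite ι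
      have : FiniteDimensional K (Submodule.span K (v '' I)) :=
        FiniteDimensional.span_of_finite K (Set.toFinite _)
      have h1 := Submodule.finrank_mono hle
      have key : ∀ S : Set ι, LinearIndepOn K v S →
          Module.finrank K (Submodule.span K (v '' S)) = S.ncard := by
        intro S hS
        have h : LinearIndependent K (fun i : S => v i) := hS
        classical
        have := finrank_span_eq_card h
        rw [← Set.range_domRestrict, ← Nat.card_coe_set_eq, Nat.card_eq_fintype_card]
        exact this
      rw [key I hI, key J hJ] at h1
      omega)
    (fun _ hI => hI.1)).matroid

theorem vectorMatroid_ground (K : Type*) {V ι : Type*} [Field K] [AddCommGroup V] [Module K V]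
    [Finite ι] (E : Set ι) (v : ι → V) : (vectorMatroid K E v).E = E := rfl

theorem vectorMatroid_indep_iff (K : Type*) {V ι : Type*} [Field K] [AddCommGroup V] [Module K V]
    [Finite ι] (E : Set ι) (v : ι → V) (I : Set ι) :
    (vectorMatroid K E v).Indep I ↔ I ⊆ E ∧ LinearIndepOn K v I := by
  simp [vectorMatroid]

/-- The independent collections of `(n-1)`-subsets of `[m]`: no `s ≥ 1` members of the
collection have more than `n - s` elements in common (equivalently, no `t + 1` of them contain a
common `(n-t)`-set). Here `S.inf id` is the intersection of the members of `S`. -/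
def CombIndep (n m : ℕ) (I : Set (Finset (Fin m))) : Prop :=
  I ⊆ {A : Finset (Fin m) | A.card + 1 = n} ∧
    ∀ S : Finset (Finset (Fin m)), S.Nonempty → (S : Set (Finset (Fin m))) ⊆ I →
      (S.inf id).card + S.card ≤ n

theorem CombIndep.empty (n m : ℕ) : CombIndep n m ∅ :=
  ⟨by simp, fun S hS hS' => by
    obtain ⟨A, hA⟩ := hS
    exact absurd (hS' hA) (by simp)⟩

theorem CombIndep.subset {n m : ℕ} {I J : Set (Finset (Fin m))} (hJ : CombIndep n m J)
    (hIJ : I ⊆ J) : CombIndep n m I :=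
  ⟨hIJ.trans hJ.1, fun S hS hS' => hJ.2 S hS (hS'.trans hIJ)⟩

theorem CombIndep.augment {n m : ℕ} {I J : Finset (Finset (Fin m))}
    (hI : CombIndep n m I) (hJ : CombIndep n m J) (hlt : I.card < J.card) :
    ∃ e ∈ J, e ∉ I ∧ CombIndep n m (insert e (I : Set (Finset (Fin m)))) := by
  classical
  by_contra! hcon
  -- tight subcollections of `I`
  let tight : Finset (Finset (Fin m)) → Prop := fun S =>
    S.Nonempty ∧ S ⊆ I ∧ n ≤ (S.inf id).card + S.card
  have hunion : ∀ S T, tight S → tight T → (S ∩ T).Nonempty → tight (S ∪ T) := by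
    rintro S T ⟨hS0, hSI, hS⟩ ⟨hT0, hTI, hT⟩ hST
    refine ⟨hS0.mono Finset.subset_union_left, Finset.union_subset hSI hTI, ?_⟩
    have h1 := hI.2 (S ∩ T) hST
      (Finset.coe_subset.2 (Finset.inter_subset_left.trans hSI))
    have h2 := Finset.card_union_add_card_inter S T
    have h3 := Finset.card_union_add_card_inter (S.inf id) (T.inf id)
    have h4 : S.inf id ∪ T.inf id ⊆ (S ∩ T).inf id :=
      Finset.union_subset (Finset.inf_mono Finset.inter_subset_left)
        (Finset.inf_mono Finset.inter_subset_right)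
    have h5 : (S ∪ T).inf id = S.inf id ∩ T.inf id := Finset.inf_union
    rw [h5]
    have h6 := Finset.card_le_card h4
    omega
  have hcover : ∀ e ∈ J, ∃ S, tight S ∧ S.inf id ⊆ e := by
    intro e he
    by_cases heI : e ∈ I
    · refine ⟨{e}, ⟨by simp, by simpa using heI, ?_⟩, by simp⟩
      have : e.card + 1 = n := hJ.1 he
      simp
      omega
    · have hbad := hcon e he heI
      have hn : e.card + 1 = n := hJ.1 he
      simp only [CombIndep, not_and, not_forall, not_le] at hbad
      obtain ⟨S, hS0, hSI, hS⟩ := hbad (by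
        rintro A (rfl | hA)
        · exact hn
        · exact hI.1 hA)
      have heS : e ∈ S := by
        by_contra heS
        have : (S : Set (Finset (Fin m))) ⊆ I := fun A hA =>
          (hSI hA).resolve_left (fun h => heS (h ▸ hA))
        have := hI.2 S hS0 this
        omega
      have hS' : S.erase e ⊆ I := by
        intro A hA
        rw [Finset.mem_erase] at hA
        exact (hSI hA.2).resolve_left hA.1
      have hins := Finset.insert_erase heS
      have hcard := Finset.card_erase_add_one heS
      have hinf : S.inf id = e ∩ (S.erase e).inf id := by
        conv_lhs => rw [← hins, Finset.inf_insert]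
        rfl
      have hne : (S.erase e).Nonempty := by
        rw [Finset.nonempty_iff_ne_empty]
        intro h0
        rw [hinf] at hS
        have := Finset.card_le_card (Finset.inter_subset_left (s₁ := e)
          (s₂ := (S.erase e).inf id))
        rw [h0, Finset.card_empty] at hcard
        omega
      have hle := hI.2 (S.erase e) hne (Finset.coe_subset.2 hS')
      have hsub : e ∩ (S.erase e).inf id ⊆ (S.erase e).inf id := Finset.inter_subset_right
      have hcl := Finset.card_le_card hsub
      rw [hinf] at hS
      refine ⟨S.erase e, ⟨hne, hS', by omega⟩, ?_⟩
      have heq := Finset.eq_of_subset_of_card_le hsub (by omega)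
      rw [← heq]
      exact Finset.inter_subset_left
  let C := I.powerset.filter (fun T => Maximal tight T)
  have hC : ∀ T ∈ C, Maximal tight T := fun T hT => (Finset.mem_filter.1 hT).2
  have hdisj : (C : Set (Finset (Finset (Fin m)))).PairwiseDisjoint id := by
    intro S hS T hT hne
    rw [Function.onFun, id, id, Finset.disjoint_iff_inter_eq_empty]
    by_contra h
    have h := hunion S T (hC S hS).prop (hC T hT).prop (Finset.nonempty_iff_ne_empty.2 h)
    exact hne (((hC S hS).eq_of_le h Finset.subset_union_left).trans
      ((hC T hT).eq_of_le h Finset.subset_union_right).symm)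
  have hJsub : J ⊆ C.biUnion (fun T => J.filter (fun e => T.inf id ⊆ e)) := by
    intro e he
    obtain ⟨S, hS, hSe⟩ := hcover e he
    obtain ⟨T, hST, hT⟩ := (Set.toFinite {S | tight S}).exists_le_maximal hS
    refine Finset.mem_biUnion.2 ⟨T, Finset.mem_filter.2
      ⟨Finset.mem_powerset.2 hT.prop.2.1, hT⟩, Finset.mem_filter.2 ⟨he, ?_⟩⟩
    have : T.inf id ≤ S.inf id := Finset.inf_mono hST
    exact le_trans this hSe
  have hpart : ∀ T ∈ C, (J.filter (fun e => T.inf id ⊆ e)).card ≤ T.card := by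
    intro T hT
    rcases (J.filter (fun e => T.inf id ⊆ e)).eq_empty_or_nonempty with h0 | h0
    · simp [h0]
    · have h1 := hJ.2 _ h0 (Finset.coe_subset.2 (Finset.filter_subset _ _))
      have h2 : T.inf id ≤ (J.filter (fun e => T.inf id ⊆ e)).inf id :=
        Finset.le_inf (fun e he => (Finset.mem_filter.1 he).2)
      have h3 := Finset.card_le_card h2
      have h4 := (hC T hT).prop.2.2
      omega
  have h1 := Finset.card_le_card hJsub
  have h2 : (C.biUnion (fun T => J.filter (fun e => T.inf id ⊆ e))).card ≤ ∑ T ∈ C, T.card :=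
    Finset.card_biUnion_le.trans (Finset.sum_le_sum hpart)
  have h3 : ∑ T ∈ C, T.card ≤ I.card := by
    have := Finset.card_biUnion (s := C) (t := id) hdisj
    simp only [id] at this
    rw [← this]
    exact Finset.card_le_card (Finset.biUnion_subset.2 fun T hT => (hC T hT).prop.2.1)
  omega

/-- The matroid `ℋ_{n,m}` on the set of `(n-1)`-subsets of `[m]`. -/
def genericMatroid (n m : ℕ) : Matroid (Finset (Fin m)) :=
  (IndepMatroid.ofFinite (E := {A : Finset (Fin m) | A.card + 1 = n}) (Set.toFinite _)
    (CombIndep n m)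
    (CombIndep.empty n m) (fun _ _ hJ hIJ => CombIndep.subset hJ hIJ)
    (by
      classical
      intro I J hI hJ hlt
      obtain ⟨I, rfl⟩ := (Set.toFinite I).exists_finset_coe
      obtain ⟨J, rfl⟩ := (Set.toFinite J).exists_finset_coe
      rw [Set.ncard_coe_finset, Set.ncard_coe_finset] at hlt
      exact hI.augment hJ hlt)
    (fun _ hI => hI.1)).matroid

theorem genericMatroid_ground (n m : ℕ) :
    (genericMatroid n m).E = {A : Finset (Fin m) | A.card + 1 = n} := rfl

theorem genericMatroid_indep_iff (n m : ℕ) (I : Set (Finset (Fin m))) :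
    (genericMatroid n m).Indep I ↔ CombIndep n m I := by
  rw [genericMatroid, IndepMatroid.matroid_Indep, IndepMatroid.ofFinite_indep]

end GenericLines

/-!
Everything except the matroid follows from the dimension formula, which holds as soon as any `n` or
fewer of the normal vectors are linearly independent. It also shows that linearly independent
lines form a collection in `CombIndep`: the lines `H_A` with `A ∈ S` lie in the flat of `⋂ S`, whose
dimension is `n - |⋂ S|`.

For the converse let `I` be a collection in `CombIndep`. The line `H_A` contains the vector of
signed maximal minors of the normal vectors indexed by `A` (`crossProd`), so the independence of
the lines `H_A`, `A ∈ I`, follows from the nonvanishing of a determinant that is polynomial in the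
normal vectors, and one arrangement where it does not vanish is enough. Since `|I| ≤ n`, there is an
embedding `g` of `I` into the set of coordinates. Take normal vectors `a` that are generic subject to
`a i (g A) = 0` for `A ∈ I` and `i ∈ A`. Then the coordinate vector of `g A` lies in `H_A`, and if
`H_A` is no larger than the line it spans, for all `A ∈ I`, the lines are independent. That amounts to
the nonvanishing of a maximal minor of a generic matrix with prescribed zeros; by Hall's marriage
theorem the required matching exists, and Hall's condition is exactly the inequality in `CombIndep`
(`exists_masked_minor_ne_zero`).
-/

namespace GenericLines

/-! ### Polynomial functions and generic properties -/

/-- A function of a matrix of complex numbers that is given by a polynomial in its entries. -/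
def IsPoly {α β : Type*} (f : (α → β → ℂ) → ℂ) : Prop :=
  ∃ p : MvPolynomial (α × β) ℂ, ∀ a, MvPolynomial.eval (fun q => a q.1 q.2) p = f a

/-- A property of complex matrices that holds off the zero set of some nonzero polynomial in the
entries. -/
def Generic {α β : Type*} (Q : (α → β → ℂ) → Prop) : Prop :=
  ∃ p : MvPolynomial (α × β) ℂ, p ≠ 0 ∧
    ∀ a, MvPolynomial.eval (fun q => a q.1 q.2) p ≠ 0 → Q a

section Generic

variable {α β : Type*}

theorem IsPoly.entry (i : α) (j : β) : IsPoly fun a : α → β → ℂ => a i j :=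
  ⟨MvPolynomial.X (i, j), fun a => by simp⟩

theorem IsPoly.const (c : ℂ) : IsPoly fun _ : α → β → ℂ => c :=
  ⟨MvPolynomial.C c, fun a => by simp⟩

theorem IsPoly.mul {f g : (α → β → ℂ) → ℂ} (hf : IsPoly f) (hg : IsPoly g) :
    IsPoly fun a => f a * g a := by
  obtain ⟨p, hp⟩ := hf
  obtain ⟨q, hq⟩ := hg
  exact ⟨p * q, fun a => by simp [hp, hq]⟩

theorem IsPoly.det {ι : Type*} [Fintype ι] [DecidableEq ι]
    {f : ι → ι → (α → β → ℂ) → ℂ} (hf : ∀ i j, IsPoly (f i j)) :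
    IsPoly fun a => (Matrix.of fun i j => f i j a).det := by
  choose p hp using hf
  refine ⟨(Matrix.of p).det, fun a => ?_⟩
  rw [RingHom.map_det]
  congr 1
  ext i j
  simp [hp]

theorem IsPoly.generic_ne_zero {f : (α → β → ℂ) → ℂ} (hf : IsPoly f) (a : α → β → ℂ)
    (ha : f a ≠ 0) : Generic fun a => f a ≠ 0 := by
  obtain ⟨p, hp⟩ := hf
  refine ⟨p, ?_, fun b hb => by rwa [hp] at hb⟩
  rintro rfl
  exact ha (by rw [← hp]; simp)

theorem Generic.mono {Q R : (α → β → ℂ) → Prop} (hQ : Generic Q) (h : ∀ a, Q a → R a) :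
    Generic R := by
  obtain ⟨p, hp, hQ⟩ := hQ
  exact ⟨p, hp, fun a ha => h a (hQ a ha)⟩

theorem Generic.and {Q R : (α → β → ℂ) → Prop} (hQ : Generic Q) (hR : Generic R) :
    Generic fun a => Q a ∧ R a := by
  obtain ⟨p, hp, hQ⟩ := hQ
  obtain ⟨q, hq, hR⟩ := hR
  refine ⟨p * q, mul_ne_zero hp hq, fun a ha => ?_⟩
  rw [map_mul] at ha
  exact ⟨hQ a (left_ne_zero_of_mul ha), hR a (right_ne_zero_of_mul ha)⟩

theorem Generic.forall {ι : Type*} [Finite ι] {Q : ι → (α → β → ℂ) → Prop}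
    (hQ : ∀ i, Generic (Q i)) : Generic fun a => ∀ i, Q i a := by
  have := Fintype.ofFinite ι
  choose p hp hQ using hQ
  refine ⟨∏ i, p i, Finset.prod_ne_zero_iff.2 fun i _ => hp i, fun a ha i => hQ i a ?_⟩
  rw [map_prod] at ha
  exact Finset.prod_ne_zero_iff.1 ha i (Finset.mem_univ i)

theorem Generic.imp {Q : (α → β → ℂ) → Prop} {c : Prop} (hQ : c → Generic Q) :
    Generic fun a => c → Q a := by
  by_cases hc : c
  · exact (hQ hc).mono fun a h _ => h
  · exact ⟨1, one_ne_zero, fun a _ h => absurd h hc⟩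

theorem Generic.exists {Q : (α → β → ℂ) → Prop} (hQ : Generic Q) : ∃ a, Q a := by
  obtain ⟨p, hp, hQ⟩ := hQ
  by_contra! h
  refine hp (MvPolynomial.funext fun x => ?_)
  by_contra hx
  exact h (fun i j => x (i, j)) (hQ _ (by simpa using hx))

end Generic

/-! ### Dimensions of the flats -/

section Flats

variable {m n : ℕ}

theorem mem_flat_hyperplane {a : Fin m → Fin n → ℂ} {A : Finset (Fin m)} {x : Fin n → ℂ} :
    x ∈ flat (fun i => hyperplane (a i)) A ↔ ∀ i ∈ A, ∑ j, a i j * x j = 0 := by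
  simp only [flat, Submodule.mem_iInf]
  rfl

theorem flat_anti (H : Fin m → Submodule ℂ (Fin n → ℂ)) {A B : Finset (Fin m)} (h : A ⊆ B) :
    flat H B ≤ flat H A :=
  biInf_mono fun _ hi => h hi

theorem flat_union (H : Fin m → Submodule ℂ (Fin n → ℂ)) (A B : Finset (Fin m)) :
    flat H (A ∪ B) = flat H A ⊓ flat H B :=
  Finset.iInf_union

theorem generic_linearIndependent {A : Finset (Fin m)} (hA : A.card ≤ n) :
    Generic fun a : Fin m → Fin n → ℂ => LinearIndependent ℂ fun i : A => a i := by
  obtain ⟨g⟩ : Nonempty (A ↪ Fin n) := Function.Embedding.nonempty_of_card_le (by simpa using hA)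
  have hp : IsPoly fun a : Fin m → Fin n → ℂ => (Matrix.of fun i j : A => a i (g j)).det :=
    IsPoly.det fun i j => IsPoly.entry _ _
  refine (hp.generic_ne_zero
    (fun i j => if h : i ∈ A then (if g ⟨i, h⟩ = j then 1 else 0) else 0) ?_).mono fun a ha => ?_
  · have : (Matrix.of fun i j : A => if h : (i : Fin m) ∈ A then
        (if g ⟨i, h⟩ = g j then (1 : ℂ) else 0) else 0) = 1 := by
      ext i j
      simp [Matrix.one_apply]
    rw [this, Matrix.det_one]
    exact one_ne_zero
  · exact LinearIndependent.of_comp (LinearMap.funLeft ℂ ℂ g)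
      (Matrix.linearIndependent_rows_of_det_ne_zero ha)

theorem finrank_flat_of_linearIndependent {a : Fin m → Fin n → ℂ} {A : Finset (Fin m)}
    (h : LinearIndependent ℂ fun i : A => a i) :
    Module.finrank ℂ (flat (fun i => hyperplane (a i)) A) = n - A.card := by
  let M : Matrix A (Fin n) ℂ := Matrix.of fun i => a i
  have hker : flat (fun i => hyperplane (a i)) A = LinearMap.ker M.mulVecLin := by
    ext x
    rw [mem_flat_hyperplane, LinearMap.mem_ker, funext_iff]
    simp [M, Matrix.mulVec, dotProduct]
  have hrank : M.rank = A.card := by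
    simpa using LinearIndependent.rank_matrix (M := M) h
  have hsum := M.mulVecLin.finrank_range_add_finrank_ker
  rw [← hker] at hsum
  simp only [Module.finrank_fintype_fun_eq_card, Fintype.card_fin] at hsum
  change M.rank + _ = n at hsum
  omega

theorem generic_finrank_flat (m n : ℕ) :
    Generic fun a : Fin m → Fin n → ℂ => ∀ A : Finset (Fin m),
      Module.finrank ℂ (flat (fun i => hyperplane (a i)) A) = n - A.card := by
  have h : Generic fun a : Fin m → Fin n → ℂ => ∀ A : Finset (Fin m), A.card ≤ n →
      LinearIndependent ℂ fun i : A => a i :=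
    Generic.forall fun A => Generic.imp generic_linearIndependent
  refine h.mono fun a ha A => ?_
  rcases le_total A.card n with hA | hA
  · exact finrank_flat_of_linearIndependent (ha A hA)
  · obtain ⟨B, hBA, hB⟩ := Finset.exists_subset_card_eq hA
    have h1 := finrank_flat_of_linearIndependent (ha B hB.le)
    have h2 := Submodule.finrank_mono (flat_anti (fun i => hyperplane (a i)) hBA)
    omega

end Flats

/-! ### The vector of maximal minors -/

/-- The generalized cross product of `k` vectors in dimension `k + 1`: the vector of their signed
maximal minors. Its dot product, without conjugation, with each of them vanishes. -/
def crossProd {k : ℕ} (b : Fin k → Fin (k + 1) → ℂ) : Fin (k + 1) → ℂ :=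
  fun j => (-1) ^ (j : ℕ) * (Matrix.of fun r c => b r (j.succAbove c)).det

theorem sum_mul_crossProd {k : ℕ} (b : Fin k → Fin (k + 1) → ℂ) (r : Fin k) :
    ∑ j, b r j * crossProd b j = 0 := by
  -- the Laplace expansion of a determinant whose row `b r` occurs twice
  have h := Matrix.det_succ_row_zero (Matrix.of (Fin.cons (b r) b : Fin (k + 1) → _ → ℂ))
  rw [Matrix.det_zero_of_row_eq (i := 0) (j := r.succ) (Fin.succ_ne_zero r).symm
    (by funext c; simp only [Matrix.of_apply, Fin.cons_zero, Fin.cons_succ])] at h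
  rw [h]
  refine Finset.sum_congr rfl fun j _ => ?_
  have : (Matrix.of (Fin.cons (b r) b : Fin (k + 1) → _ → ℂ)).submatrix Fin.succ j.succAbove =
      Matrix.of fun r c => b r (j.succAbove c) := by
    ext r c
    simp
  rw [this, crossProd]
  simp only [Matrix.of_apply, Fin.cons_zero]
  ring

theorem crossProd_eq_zero {k : ℕ} {b : Fin k → Fin (k + 1) → ℂ} {i j : Fin (k + 1)}
    (hb : ∀ r, b r i = 0) (hij : i ≠ j) : crossProd b j = 0 := by
  obtain ⟨c, hc⟩ := Fin.exists_succAbove_eq hij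
  rw [crossProd, Matrix.det_eq_zero_of_column_eq_zero c (fun r => by simp [hc, hb]), mul_zero]

theorem IsPoly.crossProd {α β : Type*} {k : ℕ} {f : Fin k → Fin (k + 1) → (α → β → ℂ) → ℂ}
    (hf : ∀ r j, IsPoly (f r j)) (j : Fin (k + 1)) :
    IsPoly fun a => crossProd (fun r j => f r j a) j :=
  (IsPoly.const _).mul (IsPoly.det fun r c => hf r (j.succAbove c))

/-! ### Generic matrices with prescribed zeros -/

section Masked

variable {m k : ℕ}

/-- The matrix `x` with the entries `(i, j)`, `i ∈ Z j`, replaced by zero. -/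
def masked (Z : Fin (k + 1) → Finset (Fin m)) (x : Fin m → Fin (k + 1) → ℂ) :
    Fin m → Fin (k + 1) → ℂ :=
  fun i j => if i ∈ Z j then 0 else x i j

theorem IsPoly.masked (Z : Fin (k + 1) → Finset (Fin m)) (i : Fin m) (j : Fin (k + 1)) :
    IsPoly fun x => masked Z x i j := by
  unfold GenericLines.masked
  split_ifs
  · exact IsPoly.const 0
  · exact IsPoly.entry i j

/-- Under Hall's condition on the zero pattern, the minor with rows `Z j` and all columns but `j`
does not vanish identically: a perfect matching that avoids the prescribed zeros gives a
permutation matrix. -/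
theorem exists_masked_minor_ne_zero {Z : Fin (k + 1) → Finset (Fin m)}
    (hZ : ∀ S : Finset (Fin (k + 1)), S.Nonempty → (S.inf Z).card + S.card ≤ k + 1)
    {j : Fin (k + 1)} {e : Fin k ↪ Fin m} (he : Finset.univ.map e = Z j) :
    ∃ x, crossProd (fun r => masked Z x (e r)) j ≠ 0 := by
  classical
  obtain ⟨f, hf, hfZ⟩ := (Finset.all_card_le_biUnion_card_iff_exists_injective
    (fun c : Fin k => Finset.univ.filter fun r => e r ∉ Z (j.succAbove c))).1 (by
      intro S
      -- the rows outside the neighbourhood of `S` lie in the intersection over `S ∪ {j}`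
      have h := hZ (insert j (S.map j.succAboveEmb)) (Finset.insert_nonempty _ _)
      rw [Finset.card_insert_of_notMem (by simp), Finset.card_map] at h
      set N := S.biUnion fun c : Fin k =>
        Finset.univ.filter fun r => e r ∉ Z (j.succAbove c) with hN
      have hsub : Nᶜ.map e ⊆ (insert j (S.map j.succAboveEmb)).inf Z := by
        rw [Finset.subset_iff]
        intro i hi
        obtain ⟨r, hr, rfl⟩ := Finset.mem_map.1 hi
        rw [Finset.mem_inf]
        intro l hl
        rcases Finset.mem_insert.1 hl with rfl | hl
        · rw [← he]
          exact Finset.mem_map_of_mem e (Finset.mem_univ r)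
        · obtain ⟨c, hc, rfl⟩ := Finset.mem_map.1 hl
          by_contra hcon
          refine Finset.mem_compl.1 hr (Finset.mem_biUnion.2 ⟨c, hc, ?_⟩)
          simpa using hcon
      have h1 := Finset.card_le_card hsub
      rw [Finset.card_map, Finset.card_compl, Fintype.card_fin] at h1
      omega)
  let σ : Equiv.Perm (Fin k) := Equiv.ofBijective f (Finite.injective_iff_bijective.1 hf)
  refine ⟨fun i l => if ∃ c, j.succAbove c = l ∧ e (f c) = i then 1 else 0, ?_⟩
  refine mul_ne_zero (pow_ne_zero _ (by norm_num)) ?_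
  have hM : (Matrix.of fun r c => masked Z
      (fun i l => if ∃ c, j.succAbove c = l ∧ e (f c) = i then 1 else 0) (e r) (j.succAbove c)) =
      (σ.permMatrix ℂ).transpose := by
    ext r c
    have hfc : e (f c) ∉ Z (j.succAbove c) := by simpa using hfZ c
    by_cases hrc : f c = r
    · subst hrc
      simp [masked, hfc, σ, Equiv.Perm.permMatrix, PEquiv.toMatrix_apply]
    · simp [masked, hrc, σ, Equiv.Perm.permMatrix, PEquiv.toMatrix_apply]
  rw [hM, Matrix.det_transpose, Matrix.det_permutation]
  exact_mod_cast (Equiv.Perm.sign σ).ne_zero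

end Masked

/-! ### Independence of the lines -/

section Lines

variable {m k : ℕ}

theorem exists_rows {A : Finset (Fin m)} (hA : A.card = k) :
    ∃ e : Fin k ↪ Fin m, Finset.univ.map e = A :=
  ⟨(A.orderEmbOfFin hA).toEmbedding, by
    apply Finset.coe_injective
    rw [Finset.coe_map, Finset.coe_univ, Set.image_univ]
    exact A.range_orderEmbOfFin hA⟩

theorem crossProd_mem_flat (a : Fin m → Fin (k + 1) → ℂ) (e : Fin k ↪ Fin m) :
    crossProd (fun r => a (e r)) ∈ flat (fun i => hyperplane (a i)) (Finset.univ.map e) := by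
  rw [mem_flat_hyperplane]
  intro i hi
  obtain ⟨r, -, rfl⟩ := Finset.mem_map.1 hi
  exact sum_mul_crossProd (fun r => a (e r)) r

/-- A nonsingular matrix of coordinates of cross products exists for every collection in
`CombIndep`. -/
theorem exists_det_crossProd_ne_zero {I : Finset (Finset (Fin m))}
    (hI : CombIndep (k + 1) m (I : Set (Finset (Fin m)))) (g : I ↪ Fin (k + 1))
    {e : I → Fin k ↪ Fin m} (he : ∀ A, Finset.univ.map (e A) = A) :
    ∃ a : Fin m → Fin (k + 1) → ℂ,
      (Matrix.of fun A B : I => crossProd (fun r => a (e A r)) (g B)).det ≠ 0 := by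
  classical
  -- the columns outside the range of `g` carry no prescribed zeros
  let Z : Fin (k + 1) → Finset (Fin m) := fun j => if h : ∃ A, g A = j then h.choose else ∅
  have hZg : ∀ A, Z (g A) = A := by
    intro A
    have h : ∃ B, g B = g A := ⟨A, rfl⟩
    simp only [Z, dif_pos h]
    exact congrArg Subtype.val (g.injective h.choose_spec)
  have hZ : ∀ S : Finset (Fin (k + 1)), S.Nonempty → (S.inf Z).card + S.card ≤ k + 1 := by
    intro S hS
    by_cases hSg : ∀ j ∈ S, ∃ A, g A = j
    · have hinj : Set.InjOn Z S := by
        intro i hi j hj hij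
        obtain ⟨A, rfl⟩ := hSg i hi
        obtain ⟨B, rfl⟩ := hSg j hj
        rw [hZg, hZg] at hij
        rw [Subtype.ext hij]
      have h := hI.2 (S.image Z) (hS.image Z) (by
        intro B hB
        obtain ⟨j, hj, rfl⟩ := Finset.mem_image.1 hB
        obtain ⟨A, rfl⟩ := hSg j hj
        rw [hZg]
        exact A.2)
      rwa [Finset.card_image_of_injOn hinj, Finset.inf_image, Function.id_comp] at h
    · push Not at hSg
      obtain ⟨j, hj, hjg⟩ := hSg
      have h0 : S.inf Z = ∅ := by
        have hj0 : Z j = ∅ := dif_neg (by simpa using hjg)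
        exact Finset.subset_empty.1 (hj0 ▸ Finset.inf_le hj)
      have := Finset.card_le_univ S
      simp_all
  obtain ⟨x, hx⟩ : ∃ x, ∀ A : I, crossProd (fun r => masked Z x (e A r)) (g A) ≠ 0 := by
    refine Generic.exists (Generic.forall fun A => ?_)
    obtain ⟨x, hx⟩ := exists_masked_minor_ne_zero hZ ((he A).trans (hZg A).symm)
    exact (IsPoly.crossProd (fun r j => IsPoly.masked Z (e A r) j) (g A)).generic_ne_zero x hx
  refine ⟨masked Z x, ?_⟩
  have hdiag : (Matrix.of fun A B : I => crossProd (fun r => masked Z x (e A r)) (g B)) =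
      Matrix.diagonal fun A => crossProd (fun r => masked Z x (e A r)) (g A) := by
    ext A B
    rcases eq_or_ne A B with rfl | hAB
    · simp
    · rw [Matrix.diagonal_apply_ne _ hAB, Matrix.of_apply]
      refine crossProd_eq_zero (i := g A) (fun r => if_pos ?_) (g.injective.ne hAB)
      rw [hZg, ← he A]
      exact Finset.mem_map_of_mem _ (Finset.mem_univ r)
  rw [hdiag, Matrix.det_diagonal]
  exact Finset.prod_ne_zero_iff.2 fun A _ => hx A

/-- Generically, the lines of a collection in `CombIndep` are independent, whichever vectors are
chosen to span them. -/
theorem generic_linearIndepOn {I : Finset (Finset (Fin m))}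
    (hI : CombIndep (k + 1) m (I : Set (Finset (Fin m)))) :
    Generic fun a : Fin m → Fin (k + 1) → ℂ => ∀ v : Finset (Fin m) → (Fin (k + 1) → ℂ),
      (∀ A : Finset (Fin m), A.card + 1 = k + 1 →
        Submodule.span ℂ {v A} = flat (fun i => hyperplane (a i)) A) →
      LinearIndepOn ℂ v (I : Set (Finset (Fin m))) := by
  classical
  obtain ⟨g⟩ : Nonempty (I ↪ Fin (k + 1)) := by
    refine Function.Embedding.nonempty_of_card_le ?_
    rcases I.eq_empty_or_nonempty with rfl | h0
    · simp
    · have := hI.2 I h0 subset_rfl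
      simp only [Fintype.card_coe, Fintype.card_fin]
      omega
  have hcard : ∀ A : I, (A : Finset (Fin m)).card + 1 = k + 1 := fun A => hI.1 A.2
  choose e he using fun A : I => exists_rows (Nat.succ_injective (hcard A))
  obtain ⟨a₀, ha₀⟩ := exists_det_crossProd_ne_zero hI g he
  have hp : IsPoly fun a : Fin m → Fin (k + 1) → ℂ =>
      (Matrix.of fun A B : I => crossProd (fun r => a (e A r)) (g B)).det :=
    IsPoly.det fun A B => IsPoly.crossProd (fun r j => IsPoly.entry (e A r) j) (g B)
  refine (hp.generic_ne_zero a₀ ha₀).mono fun a ha v hv => ?_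
  have hmul : ∀ A : I, ∃ c : ℂ, c • v A = crossProd fun r => a (e A r) := by
    intro A
    rw [← Submodule.mem_span_singleton, hv A (hcard A)]
    have := crossProd_mem_flat a (e A)
    rwa [he A] at this
  choose c hc using hmul
  have hfac : (Matrix.of fun A B : I => crossProd (fun r => a (e A r)) (g B)) =
      Matrix.diagonal c * Matrix.of fun A B : I => v A (g B) := by
    ext A B
    rw [Matrix.diagonal_mul, Matrix.of_apply, ← hc A]
    rfl
  rw [hfac, Matrix.det_mul] at ha
  exact LinearIndependent.of_comp (LinearMap.funLeft ℂ ℂ g)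
    (Matrix.linearIndependent_rows_of_det_ne_zero (right_ne_zero_of_mul ha))

end Lines

/-! ### Consequences of the dimension formula -/

section Dimension

variable {m n : ℕ} {H : Fin m → Submodule ℂ (Fin n → ℂ)}

theorem flat_injOn (hH : ∀ A : Finset (Fin m), Module.finrank ℂ (flat H A) = n - A.card) :
    Set.InjOn (flat H) {A : Finset (Fin m) | A.card + 1 = n} := by
  intro A hA B hB hAB
  simp only [Set.mem_ofPred_eq] at hA hB
  -- the common line lies in the flat of `A ∪ B`, so `A ∪ B` has only `n - 1` elements
  have h := hH (A ∪ B)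
  rw [flat_union, ← hAB, inf_idem, hH A] at h
  have h1 := Finset.eq_of_subset_of_card_le (Finset.subset_union_left (s₁ := A) (s₂ := B))
    (by omega)
  have h2 := Finset.eq_of_subset_of_card_le (Finset.subset_union_right (s₁ := A) (s₂ := B))
    (by omega)
  exact h1.trans h2.symm

theorem ncard_lines (hn : 1 ≤ n)
    (hH : ∀ A : Finset (Fin m), Module.finrank ℂ (flat H A) = n - A.card) :
    {L : Submodule ℂ (Fin n → ℂ) | Module.finrank ℂ L = 1 ∧
      ∃ A : Finset (Fin m), L = flat H A}.ncard = m.choose (n - 1) := by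
  have himage : {L : Submodule ℂ (Fin n → ℂ) | Module.finrank ℂ L = 1 ∧
      ∃ A : Finset (Fin m), L = flat H A} =
      flat H '' {A : Finset (Fin m) | A.card + 1 = n} := by
    ext L
    constructor
    · rintro ⟨hL, A, rfl⟩
      rw [hH] at hL
      exact ⟨A, by simp only [Set.mem_ofPred_eq]; omega, rfl⟩
    · rintro ⟨A, hA, rfl⟩
      simp only [Set.mem_ofPred_eq] at hA
      exact ⟨by rw [hH]; omega, A, rfl⟩
  have hE : {A : Finset (Fin m) | A.card + 1 = n} =
      (Finset.powersetCard (n - 1) Finset.univ : Finset (Finset (Fin m))) := by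
    ext A
    simp only [Set.mem_ofPred_eq, Finset.mem_coe, Finset.mem_powersetCard_univ]
    omega
  rw [himage, (flat_injOn hH).ncard_image, hE, Set.ncard_coe_finset, Finset.card_powersetCard,
    Finset.card_univ, Fintype.card_fin]

theorem combIndep_of_linearIndepOn
    (hH : ∀ A : Finset (Fin m), Module.finrank ℂ (flat H A) = n - A.card)
    {v : Finset (Fin m) → (Fin n → ℂ)}
    (hv : ∀ A : Finset (Fin m), A.card + 1 = n → Submodule.span ℂ {v A} = flat H A)
    {I : Set (Finset (Fin m))} (hIE : I ⊆ {A : Finset (Fin m) | A.card + 1 = n})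
    (hI : LinearIndepOn ℂ v I) : CombIndep n m I := by
  refine ⟨hIE, fun S hS hSI => ?_⟩
  have hlin : LinearIndependent ℂ fun A : S => v A := hI.mono hSI
  have hspan : Submodule.span ℂ (Set.range fun A : S => v A) ≤ flat H (S.inf id) := by
    rw [Submodule.span_le]
    rintro _ ⟨A, rfl⟩
    have hA : v A ∈ flat H A := by
      rw [← hv A (hIE (hSI A.2))]
      exact Submodule.mem_span_singleton_self _
    exact flat_anti H (Finset.inf_le (f := id) A.2) hA
  have h := Submodule.finrank_mono hspan
  rw [finrank_span_eq_card hlin, hH, Fintype.card_coe] at h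
  have := hS.card_pos
  omega

end Dimension

end GenericLines

theorem theorem2p2 (n m : ℕ) (hn : 1 ≤ n) :
    GenericLines.ForGenericArrangement m n fun H =>
      -- the intersections have the expected dimension; those of `n - 1` hyperplanes are lines
      (∀ A : Finset (Fin m), Module.finrank ℂ (GenericLines.flat H A) = n - A.card) ∧
      -- the one-dimensional intersections form `m.choose (n - 1)` distinct lines
      Set.InjOn (GenericLines.flat H) {A : Finset (Fin m) | A.card + 1 = n} ∧
      {L : Submodule ℂ (Fin n → ℂ) | Module.finrank ℂ L = 1 ∧
        ∃ A : Finset (Fin m), L = GenericLines.flat H A}.ncard = m.choose (n - 1) ∧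
      -- their matroid, computed from any vectors spanning them, is `ℋ_{n,m}`
      ∀ v : Finset (Fin m) → (Fin n → ℂ),
        (∀ A : Finset (Fin m), A.card + 1 = n →
          Submodule.span ℂ {v A} = GenericLines.flat H A) →
        GenericLines.vectorMatroid ℂ {A : Finset (Fin m) | A.card + 1 = n} v =
          GenericLines.genericMatroid n m := by
  obtain ⟨k, rfl⟩ : ∃ k, n = k + 1 := ⟨n - 1, by omega⟩
  obtain ⟨P, hP, h⟩ := (GenericLines.generic_finrank_flat m (k + 1)).and
    (GenericLines.Generic.forall fun I : Finset (Finset (Fin m)) =>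
      GenericLines.Generic.imp (c := GenericLines.CombIndep (k + 1) m I)
        GenericLines.generic_linearIndepOn)
  refine ⟨P, hP, fun a ha => ?_⟩
  obtain ⟨hdim, hind⟩ := h a ha
  refine ⟨fun i hi => ?_, hdim, GenericLines.flat_injOn hdim,
    GenericLines.ncard_lines hn hdim, fun v hv => ?_⟩
  · -- a zero normal vector would give a flat of dimension `k + 1` instead of `k`
    have htop : GenericLines.flat (fun i => GenericLines.hyperplane (a i)) {i} = ⊤ := by
      rw [eq_top_iff]
      intro x _
      simp [GenericLines.mem_flat_hyperplane, hi]
    have h1 := hdim {i}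
    rw [htop, finrank_top, Module.finrank_fin_fun, Finset.card_singleton] at h1
    omega
  · refine Matroid.ext_indep rfl fun I hIE => ?_
    rw [GenericLines.vectorMatroid_indep_iff, GenericLines.genericMatroid_indep_iff]
    refine ⟨fun hI => GenericLines.combIndep_of_linearIndepOn hdim hv hI.1 hI.2,
      fun hI => ⟨hI.1, ?_⟩⟩
    obtain ⟨I, rfl⟩ := (Set.toFinite I).exists_finset_coe
    exact hind I hI v hv
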